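/- Work in the pointer machine model: a data structure for a finite input set $P\subset\mathbb{R}^2$ is a finite directed graph in which every cell stores one element of $P$ and two pointers to cells (possibly to itself); its space is the number of cells. A query with output set $A\subseteq P$ is answered in time $t$ if there is a set $W$ of at most $t$ cells such that every element of $A$ is stored in some cell of $W$ and, from some cell of $W$, all cells of $W$ can be reached along pointers without leaving $W$ (the empty $W$ is allowed; nothing else is charged). In 2D annulus reporting, a query is an annulus $\{x\in\mathbb{R}^2 : r\le |x-c|\le R\}$ with $c\in\mathbb{R}^2$ and $0<r<R$, and its output is the set of the points of $P$ in the annulus. A data structure solves 2D annulus reporting with query time $Q(n)+Ck$ and space $S(n)$ if it assigns to every finite $P\subset\mathbb{R}^2$ a structure as above with at most $S(n)$ cells that answers every annulus query in time at most $Q(n)+Ck$, where $n=|P|$ and $k$ is the number of points in the output. **Theorem.** (i) For every constant $C$ there are a function $\eta(n)\to 0$ and an $N$ such that every data structure that solves 2D annulus reporting with query time $Q(n)+Ck$, where $Q(n)\ge 1$ for all $n$, and with space $S(n)$ satisfies $$S(n)\ \ge\ \frac{n^{3-\eta(n)}}{Q(n)^5}\qquad\text{for all } n\ge N.$$ (ii)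 Consequently, if $Q(n)=\log^{O(1)}n$ then $S(n)\ge n^{3-o(1)}$. (iii) In particular, no data structure solves 2D annulus reporting with query time $Q(n)+O(k)$, $Q(n)=\log^{O(1)}n$, and space $n^{2+o(1)}$. -/

import Mathlib

open Filter Topology Asymptotics

/-- The Euclidean plane. -/
abbrev Plane : Type := EuclideanSpace ℝ (Fin 2)

/-- The (closed) region between the concentric circles of radii `r` and `R` around `c`. -/
def planarAnnulus (c : Plane) (r R : ℝ) : Set Plane :=
  {x | r ≤ dist x c ∧ dist x c ≤ R}

open Classical in
/-- The points of the input set `P` that lie in the range `A`, i.e. the output of the query `A`. -/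
noncomputable def pointsIn (P : Finset Plane) (A : Set Plane) : Finset Plane :=
  P.filter (fun x => x ∈ A)

/-- A data structure in the pointer machine model on the input set `P`: a finite directed graph in
which every cell stores one input element and two pointers to cells. A cell may point to itself,
which plays the role of a null pointer. -/
structure PointerStructure (P : Finset Plane) where
  /-- The number of cells, i.e. the space. -/
  size : ℕ
  /-- The input element stored in a cell. -/
  elem : Fin size → {x : Plane // x ∈ P}
  /-- The two pointers of a cell. -/
  ptr : Fin size → Fin 2 → Fin size

namespace PointerStructure

variable {P : Finset Plane}

/-- A pointer navigation from cell `a` to cell `b` that stays inside the set `W` of cells. -/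
def Step (D : PointerStructure P) (W : Finset (Fin D.size)) (a b : Fin D.size) : Prop :=
  a ∈ W ∧ b ∈ W ∧ ∃ i : Fin 2, D.ptr a i = b

/-- The cells in `W` span a subgraph that is connected by pointer navigation: from some cell of `W`
(which may be chosen freely) all cells of `W` can be reached along pointers without leaving `W`.
The empty subgraph counts as connected. -/
def IsNavigable (D : PointerStructure P) (W : Finset (Fin D.size)) : Prop :=
  W = ∅ ∨ ∃ a ∈ W, ∀ b ∈ W, Relation.ReflTransGen (D.Step W) a b

/-- The query with output `A` can be answered in time `t`: there is a connected subgraph with at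
most `t` cells in which every element of `A` is stored. The least such `t` is the size of the
smallest such subgraph; neither the computation nor the knowledge needed to find it is charged. -/
def AnswersInTime (D : PointerStructure P) (A : Finset Plane) (t : ℝ) : Prop :=
  ∃ W : Finset (Fin D.size), D.IsNavigable W ∧
    (∀ x ∈ A, ∃ v ∈ W, (D.elem v : Plane) = x) ∧ (W.card : ℝ) ≤ t

end PointerStructure

/-- The data structure `D` (one pointer structure for every finite input set) answers annulus
reporting queries on `n` points in time `Q n + C * k`, where `k` is the size of the output. -/
def SolvesAnnulusReporting (D : (P : Finset Plane) → PointerStructure P)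
    (Q : ℕ → ℝ) (C : ℝ) : Prop :=
  ∀ (P : Finset Plane) (c : Plane) (r R : ℝ), 0 < r → r < R →
    (D P).AnswersInTime (pointsIn P (planarAnnulus c r R))
      (Q P.card + C * (pointsIn P (planarAnnulus c r R)).card)

/-- The data structure `D` uses at most `S n` cells on every input set of `n` points. -/
def UsesSpace (D : (P : Finset Plane) → PointerStructure P) (S : ℕ → ℝ) : Prop :=
  ∀ P : Finset Plane, ((D P).size : ℝ) ≤ S P.card

/-- `Q n = (log n) ^ O(1)`. -/
def IsPolylogarithmic (Q : ℕ → ℝ) : Prop :=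
  ∃ b : ℕ, Q =O[atTop] fun n : ℕ => Real.log (n : ℝ) ^ b

/-!
Lower bound for reporting the points in a planar annulus on a pointer machine.

Suppose that `m` queries have outputs of at least `K` elements each, where `K` exceeds the additive
query time, and that any two outputs share at most `β` elements. The subgraph that answers a query
has size proportional to its output, so a double count shows that a constant fraction of `K` cells
have more than `β` elements of the output within a constant distance. A cell has boundedly many
elements within a constant distance, and more than `β` of them determine the query, so that it
plays this role for boundedly many queries. Hence there are `Ω(m * K)` cells
(`PointerStructure.card_mul_le_size`).

The queries are annuli of width about `W / n` with `W = 80 * Q * n ^ δ`. The functions that define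
two circles differ by an affine function, so that two annuli meet in the intersection of one of them
with a narrow strip. In the worst case, a tangency, this is controlled by a quadratic polynomial
(`card_commonColumns_le_of_vertical`); if the centers differ only horizontally, the strip is
vertical and crosses the annuli transversally (`card_commonColumns_le_of_horizontal`); concentric
ones of different radii are disjoint. Therefore the grid of centers and radii can be finer in some
directions than in others, and `n ^ (3 - O(δ)) / Q ^ 6` annuli are pairwise almost disjoint
(`exists_separated_annuli`).

The input has one point with abscissa `i / n` for every `i < n`, with a random ordinate `j / n`. By
an exponential moment bound and a union bound, with positive probability every annulus contains
`Q * n ^ δ` points while any two annuli share only a number of points that is bounded in terms of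
`δ` (`exists_hits_and_common_hits_le`, `exists_hard_configuration`). This gives
`n ^ (3 - O(δ)) / Q ^ 5` cells for every fixed `δ > 0`, uniformly in the data structure, and letting
`δ` tend to zero slowly gives the theorem.
-/

/-! ### Local structure of a pointer structure -/

namespace PointerStructure

variable {P : Finset Plane}

/-- The cells that can be reached from `r` by following at most `L` pointers. -/
def reach (D : PointerStructure P) : ℕ → Fin D.size → Finset (Fin D.size)
  | 0, r => {r}
  | L + 1, r => insert r (Finset.univ.biUnion fun i => D.reach L (D.ptr r i))

/-- The input elements stored within `L` pointer navigations of `r`. -/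
noncomputable def stored (D : PointerStructure P) (L : ℕ) (r : Fin D.size) : Finset Plane := by
  classical exact (D.reach L r).image fun v => (D.elem v : Plane)

lemma mem_stored {D : PointerStructure P} {L : ℕ} {r : Fin D.size} {x : Plane} :
    x ∈ D.stored L r ↔ ∃ v ∈ D.reach L r, (D.elem v : Plane) = x := by
  classical
  simp [stored]

lemma self_mem_reach (D : PointerStructure P) (L : ℕ) (r : Fin D.size) : r ∈ D.reach L r := by
  cases L <;> simp [reach]

lemma reach_subset_succ (D : PointerStructure P) (L : ℕ) (r : Fin D.size) :
    D.reach L r ⊆ D.reach (L + 1) r := by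
  induction L generalizing r with
  | zero =>
    intro x hx
    have : x = r := by simpa [reach] using hx
    exact this ▸ D.self_mem_reach 1 r
  | succ L ih =>
    rw [reach, reach]
    exact Finset.insert_subset_insert _ (Finset.biUnion_mono fun i _ => ih _)

lemma mem_reach_succ_of_ptr {D : PointerStructure P} {L : ℕ} {u w : Fin D.size} (i : Fin 2)
    (h : w ∈ D.reach L (D.ptr u i)) : w ∈ D.reach (L + 1) u := by
  rw [reach]
  exact Finset.mem_insert_of_mem (Finset.mem_biUnion.2 ⟨i, Finset.mem_univ _, h⟩)

lemma card_reach_lt (D : PointerStructure P) (L : ℕ) (r : Fin D.size) :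
    (D.reach L r).card < 2 ^ (L + 1) := by
  induction L generalizing r with
  | zero => simp [reach]
  | succ L ih =>
    have h1 := Finset.card_insert_le r (Finset.univ.biUnion fun i => D.reach L (D.ptr r i))
    have h2 := Finset.card_biUnion_le (s := (Finset.univ : Finset (Fin 2)))
      (t := fun i => D.reach L (D.ptr r i))
    rw [Fin.sum_univ_two] at h2
    have h3 := ih (D.ptr r 0)
    have h4 := ih (D.ptr r 1)
    rw [reach, pow_succ]
    omega

lemma card_stored_le (D : PointerStructure P) (L : ℕ) (r : Fin D.size) :
    (D.stored L r).card ≤ 2 ^ (L + 1) := by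
  classical
  exact Finset.card_image_le.trans (D.card_reach_lt L r).le

/-- In a subgraph `W` navigable from `a`, a cell `w` is either close to `a` or close to many cells
of `W`: as long as `a` is not among the cells that reach `w` in `L` steps, a path from `a` to `w`
enters this set, so that one more step enlarges it. -/
lemma mem_reach_or_le_card (D : PointerStructure P) (W : Finset (Fin D.size)) {a w : Fin D.size}
    (ha : a ∈ W) (hw : w ∈ W) (haw : Relation.ReflTransGen (D.Step W) a w) (L : ℕ) :
    w ∈ D.reach L a ∨ L + 1 ≤ (W.filter fun r => w ∈ D.reach L r).card := by
  induction L with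
  | zero =>
    right
    exact Finset.card_pos.2 ⟨w, Finset.mem_filter.2 ⟨hw, D.self_mem_reach 0 w⟩⟩
  | succ L ih =>
    by_cases hLa : w ∈ D.reach L a
    · exact Or.inl (D.reach_subset_succ L a hLa)
    right
    have hcard := ih.resolve_left hLa
    obtain ⟨u, u', hstep, hu, hu'⟩ :
        ∃ u u', D.Step W u u' ∧ w ∉ D.reach L u ∧ w ∈ D.reach L u' := by
      by_contra! hno
      refine hLa ?_
      induction haw using Relation.ReflTransGen.head_induction_on with
      | refl => exact D.self_mem_reach L w
      | head h _ ih' =>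
        by_contra hx
        exact hno _ _ h hx (by
          by_contra hc
          exact hc (ih' h.2.1 (Or.inr hcard) hc))
    obtain ⟨huW, hu'W, i, rfl⟩ := hstep
    have hsub : insert u (W.filter fun r => w ∈ D.reach L r) ⊆
        W.filter fun r => w ∈ D.reach (L + 1) r := by
      intro r hr
      rcases Finset.mem_insert.1 hr with rfl | hr
      · exact Finset.mem_filter.2 ⟨huW, mem_reach_succ_of_ptr i hu'⟩
      · rw [Finset.mem_filter] at hr ⊢
        exact ⟨hr.1, D.reach_subset_succ L r hr.2⟩
    have := Finset.card_le_card hsub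
    rw [Finset.card_insert_of_notMem (by simp [hu])] at this
    omega

open Classical in
/-- If a query with output `A` is answered by at most `γ * #A` cells, then a constant fraction of
`#A` many cells have more than `β` elements of `A` within a constant distance. This is a double
count of the pairs of a cell `r` of the answering subgraph and an element of `A` near `r`. -/
lemma card_le_mul_card_rich (D : PointerStructure P) {A : Finset Plane} {W : Finset (Fin D.size)}
    (hnav : D.IsNavigable W) (hA : ∀ x ∈ A, ∃ v ∈ W, (D.elem v : Plane) = x) {β γ L : ℕ}
    (hW : W.card ≤ γ * A.card) (hL : L = γ * β + 1) (hk : 2 ^ (L + 1) * (L + 1) ≤ A.card) :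
    A.card ≤ 2 ^ (L + 1) *
      (Finset.univ.filter fun r => β < (A ∩ D.stored L r).card).card := by
  rcases hnav with rfl | ⟨a, haW, hreach⟩
  · have : A = ∅ := by
      refine Finset.eq_empty_of_forall_notMem fun x hx => ?_
      obtain ⟨v, hv, _⟩ := hA x hx
      simp at hv
    simp [this]
  set G := W.filter fun r => β < (A ∩ D.stored L r).card
  have hG : G.card ≤ (Finset.univ.filter fun r => β < (A ∩ D.stored L r).card).card :=
    Finset.card_le_card (Finset.filter_subset_filter _ (Finset.subset_univ _))
  have hlow : (A \ D.stored L a).card * (L + 1) ≤ ∑ r ∈ W, (A ∩ D.stored L r).card := by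
    have hcomm : ∑ r ∈ W, (A ∩ D.stored L r).card =
        ∑ x ∈ A, (W.filter fun r => x ∈ D.stored L r).card := by
      simp_rw [← Finset.filter_mem_eq_inter]
      exact Finset.sum_card_bipartiteAbove_eq_sum_card_bipartiteBelow
        (fun r x => x ∈ D.stored L r)
    rw [hcomm, ← smul_eq_mul]
    refine (Finset.card_nsmul_le_sum _ _ _ fun x hx => ?_).trans
      (Finset.sum_le_sum_of_subset Finset.sdiff_subset)
    rw [Finset.mem_sdiff] at hx
    obtain ⟨v, hv, rfl⟩ := hA x hx.1
    rcases D.mem_reach_or_le_card W haW hv (hreach v hv) L with h | h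
    · exact absurd (mem_stored.2 ⟨v, h, rfl⟩) hx.2
    · refine h.trans (Finset.card_le_card fun r hr => ?_)
      rw [Finset.mem_filter] at hr ⊢
      exact ⟨hr.1, mem_stored.2 ⟨v, hr.2, rfl⟩⟩
  have hup : ∑ r ∈ W, (A ∩ D.stored L r).card ≤ W.card * β + G.card * 2 ^ (L + 1) := by
    have : ∀ r ∈ W, (A ∩ D.stored L r).card ≤
        β + if β < (A ∩ D.stored L r).card then 2 ^ (L + 1) else 0 := by
      intro r _
      split_ifs with h
      · exact (Finset.card_le_card Finset.inter_subset_right).trans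
          ((D.card_stored_le L r).trans (Nat.le_add_left _ _))
      · omega
    refine (Finset.sum_le_sum this).trans (le_of_eq ?_)
    rw [Finset.sum_add_distrib, Finset.sum_const, smul_eq_mul, ← Finset.sum_filter,
      Finset.sum_const, smul_eq_mul]
  have hsd : A.card ≤ (A \ D.stored L a).card + 2 ^ (L + 1) :=
    (Finset.card_le_card_sdiff_add_card).trans (Nat.add_le_add_left (D.card_stored_le L a) _)
  have h1 : A.card * (L + 1) ≤ (A \ D.stored L a).card * (L + 1) + 2 ^ (L + 1) * (L + 1) := by
    rw [← add_mul]
    exact Nat.mul_le_mul_right _ hsd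
  have h2 : W.card * β ≤ γ * A.card * β := Nat.mul_le_mul_right _ hW
  have h3 : A.card * (L + 1) = γ * A.card * β + 2 * A.card := by
    rw [hL]; ring
  have h4 : G.card * 2 ^ (L + 1) ≤ 2 ^ (L + 1) *
      (Finset.univ.filter fun r => β < (A ∩ D.stored L r).card).card := by
    rw [mul_comm]
    exact Nat.mul_le_mul_left _ hG
  omega

open Classical in
/-- The space lower bound behind everything: `m` queries with outputs of at least `K` elements, any
two of which share at most `β` elements, force `Ω(m * K)` cells. A cell is rich for a query if more
than `β` of its output elements are nearby; a cell is rich for boundedly many queries, because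
these are told apart by the subset of the boundedly many nearby elements that they report. -/
theorem card_mul_le_size {ι : Type*} [Fintype ι] (D : PointerStructure P) (A : ι → Finset Plane)
    {β γ L K : ℕ} (hans : ∀ q, D.AnswersInTime (A q) ((γ : ℝ) * (A q).card))
    (hinter : ∀ q q', q ≠ q' → (A q ∩ A q').card ≤ β) (hL : L = γ * β + 1)
    (hK : ∀ q, K ≤ (A q).card) (hLK : 2 ^ (L + 1) * (L + 1) ≤ K) :
    Fintype.card ι * K ≤ 2 ^ (L + 1) * 2 ^ 2 ^ (L + 1) * D.size := by
  have h1 : ∀ q, K ≤ 2 ^ (L + 1) *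
      (Finset.univ.filter fun r => β < (A q ∩ D.stored L r).card).card := by
    intro q
    obtain ⟨W, hnav, hA, hW⟩ := hans q
    exact (hK q).trans
      (D.card_le_mul_card_rich hnav hA (by exact_mod_cast hW) hL (hLK.trans (hK q)))
  have h2 : ∀ r, (Finset.univ.filter fun q => β < (A q ∩ D.stored L r).card).card ≤
      2 ^ 2 ^ (L + 1) := by
    intro r
    have hle : (Finset.univ.filter fun q => β < (A q ∩ D.stored L r).card).card ≤
        (D.stored L r).powerset.card := by
      refine Finset.card_le_card_of_injOn (fun q => A q ∩ D.stored L r)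
        (fun q _ => Finset.mem_coe.2 (Finset.mem_powerset.2 Finset.inter_subset_right)) ?_
      intro q hq q' _ heq
      by_contra hne
      have hq1 : β < (A q ∩ D.stored L r).card := (Finset.mem_filter.1 (Finset.mem_coe.1 hq)).2
      refine absurd (hinter q q' hne) (not_le.2 (hq1.trans_le (Finset.card_le_card ?_)))
      refine Finset.subset_inter Finset.inter_subset_left ?_
      have heq' : A q ∩ D.stored L r = A q' ∩ D.stored L r := heq
      rw [heq']
      exact Finset.inter_subset_left
    rw [Finset.card_powerset] at hle
    exact hle.trans (Nat.pow_le_pow_right (by norm_num) (D.card_stored_le L r))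
  calc Fintype.card ι * K = ∑ _q : ι, K := by simp
    _ ≤ ∑ q : ι, 2 ^ (L + 1) *
          (Finset.univ.filter fun r => β < (A q ∩ D.stored L r).card).card :=
        Finset.sum_le_sum fun q _ => h1 q
    _ = 2 ^ (L + 1) * ∑ r : Fin D.size,
          (Finset.univ.filter fun q => β < (A q ∩ D.stored L r).card).card := by
        rw [← Finset.mul_sum]
        congr 1
        exact Finset.sum_card_bipartiteAbove_eq_sum_card_bipartiteBelow
          (fun q r => β < (A q ∩ D.stored L r).card)
    _ ≤ 2 ^ (L + 1) * ∑ _r : Fin D.size, 2 ^ 2 ^ (L + 1) :=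
        Nat.mul_le_mul_left _ (Finset.sum_le_sum fun r _ => h2 r)
    _ = 2 ^ (L + 1) * 2 ^ 2 ^ (L + 1) * D.size := by
        simp only [Finset.sum_const, Finset.card_univ, Fintype.card_fin, smul_eq_mul]
        ring

end PointerStructure

/-! ### Random points in columns -/

/-- The number of columns `i` in which the point of height `f i` hits the target `J i`. -/
def hits {n : ℕ} (J : Fin n → Finset (Fin n)) (f : Fin n → Fin n) : ℕ :=
  (Finset.univ.filter fun i => f i ∈ J i).card

/-- Exponential moments of the number of hits of a uniformly random `f`. -/
lemma sum_pow_hits_le {n : ℕ} (J : Fin n → Finset (Fin n)) {z : ℝ} (hz : 0 ≤ z) :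
    ∑ f : Fin n → Fin n, z ^ hits J f ≤
      (n : ℝ) ^ n * Real.exp ((z - 1) * ((∑ i, ((J i).card : ℝ)) / n)) := by
  have h1 : ∀ f : Fin n → Fin n, z ^ hits J f = ∏ i, if f i ∈ J i then z else 1 := by
    intro f
    rw [Finset.prod_ite]
    simp [hits]
  have h2 : ∀ i, ∑ j : Fin n, (if j ∈ J i then z else 1) = n + (z - 1) * (J i).card := by
    intro i
    have : ∀ j, (if j ∈ J i then z else 1) = 1 + if j ∈ J i then z - 1 else 0 := by
      intro j
      split_ifs <;> ring
    simp_rw [this]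
    rw [Finset.sum_add_distrib, ← Finset.sum_filter]
    simp only [Finset.sum_const, Finset.card_univ, Fintype.card_fin, nsmul_eq_mul, mul_one,
      Finset.filter_mem_eq_inter, Finset.univ_inter]
    ring
  have h3 : ∑ f : Fin n → Fin n, z ^ hits J f = ∏ i, ((n : ℝ) + (z - 1) * (J i).card) := by
    simp_rw [h1, ← h2]
    rw [Finset.prod_univ_sum, Fintype.piFinset_univ]
  rw [h3, Finset.sum_div, Finset.mul_sum, Real.exp_sum]
  have h4 : (n : ℝ) ^ n = ∏ _i : Fin n, (n : ℝ) := by simp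
  rw [h4, ← Finset.prod_mul_distrib]
  refine Finset.prod_le_prod (fun i _ => ?_) fun i _ => ?_
  · have hc : ((J i).card : ℝ) ≤ n := by
      exact_mod_cast (Finset.card_le_univ (J i)).trans_eq (Fintype.card_fin n)
    have := mul_nonneg hz (Nat.cast_nonneg (α := ℝ) (J i).card)
    linarith
  · have hn : (0 : ℝ) < n := by exact_mod_cast i.pos
    have := Real.add_one_le_exp ((z - 1) * ((J i).card / n))
    calc (n : ℝ) + (z - 1) * (J i).card = n * ((z - 1) * ((J i).card / n) + 1) := by
          field_simp
          ring
      _ ≤ _ := mul_le_mul_of_nonneg_left this hn.le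

/-- A union bound: if every query expects at least `4 * K` hits, and any two queries expect at most
`1 / z` common hits with `z` large enough in terms of the number of queries, then for some choice
of the points every query gets `K` hits and any two queries share at most `β`. -/
theorem exists_hits_and_common_hits_le {ι : Type*} [Fintype ι] {n : ℕ} (hn : 0 < n)
    (J : ι → Fin n → Finset (Fin n)) {K z : ℝ} {β : ℕ} (hz : 1 ≤ z)
    (hlow : ∀ q, 4 * K ≤ (∑ i, ((J q i).card : ℝ)) / n)
    (hpair : ∀ q q', q ≠ q' → z * ((∑ i, ((J q i ∩ J q' i).card : ℝ)) / n) ≤ 1)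
    (hK : 0 ≤ K)
    (hm : Fintype.card ι * Real.exp (-K) +
      (Fintype.card ι : ℝ) ^ 2 * (Real.exp 1 / z ^ (β + 1)) < 1) :
    ∃ f : Fin n → Fin n, (∀ q, K ≤ hits (J q) f) ∧
      ∀ q q', q ≠ q' → hits (fun i => J q i ∩ J q' i) f ≤ β := by
  classical
  by_contra! hno
  have hz0 : 0 < z := one_pos.trans_le hz
  -- Markov's inequality, for `exp (-hits)` in the lower tail and `z ^ hits` in the upper tail:
  -- whenever `f` fails, one of these summands is at least `1`.
  have hcover : ∀ f : Fin n → Fin n, (1 : ℝ) ≤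
      ∑ q, Real.exp K * Real.exp (-1) ^ hits (J q) f +
        ∑ q, ∑ q', if q = q' then 0 else
          z ^ hits (fun i => J q i ∩ J q' i) f / z ^ (β + 1) := by
    intro f
    have hnn1 : ∀ q, 0 ≤ Real.exp K * Real.exp (-1) ^ hits (J q) f := fun q => by positivity
    have hnn2 : ∀ q q', (0 : ℝ) ≤ if q = q' then 0 else
        z ^ hits (fun i => J q i ∩ J q' i) f / z ^ (β + 1) := fun q q' => by
      split_ifs
      · exact le_rfl
      · positivity
    by_cases hf : ∀ q, K ≤ hits (J q) f
    · obtain ⟨q, q', hne, hlt⟩ := hno f hf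
      refine le_add_of_nonneg_of_le (Finset.sum_nonneg fun q _ => hnn1 q) ?_
      refine le_trans ?_ (Finset.single_le_sum (f := fun q => ∑ q', if q = q' then (0 : ℝ) else
          z ^ hits (fun i => J q i ∩ J q' i) f / z ^ (β + 1))
        (fun q _ => Finset.sum_nonneg fun q' _ => hnn2 q q') (Finset.mem_univ q))
      refine le_trans ?_ (Finset.single_le_sum (f := fun q' => if q = q' then (0 : ℝ) else
          z ^ hits (fun i => J q i ∩ J q' i) f / z ^ (β + 1))
        (fun q' _ => hnn2 q q') (Finset.mem_univ q'))
      rw [if_neg hne, one_le_div (by positivity)]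
      exact pow_le_pow_right₀ hz hlt
    · push Not at hf
      obtain ⟨q, hq⟩ := hf
      refine le_add_of_le_of_nonneg ?_
        (Finset.sum_nonneg fun q _ => Finset.sum_nonneg fun q' _ => hnn2 q q')
      refine le_trans ?_ (Finset.single_le_sum
        (f := fun q => Real.exp K * Real.exp (-1) ^ hits (J q) f)
        (fun q _ => hnn1 q) (Finset.mem_univ q))
      rw [← Real.exp_nat_mul, ← Real.exp_add]
      exact Real.one_le_exp (by linarith)
  have hsum := Finset.sum_le_sum fun f (_ : f ∈ (Finset.univ : Finset (Fin n → Fin n))) => hcover f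
  have hleft : ∀ q, ∑ f : Fin n → Fin n, Real.exp K * Real.exp (-1) ^ hits (J q) f ≤
      (n : ℝ) ^ n * Real.exp (-K) := by
    intro q
    rw [← Finset.mul_sum]
    calc Real.exp K * ∑ f : Fin n → Fin n, Real.exp (-1) ^ hits (J q) f
        ≤ Real.exp K * ((n : ℝ) ^ n *
          Real.exp ((Real.exp (-1) - 1) * ((∑ i, ((J q i).card : ℝ)) / n))) :=
          mul_le_mul_of_nonneg_left (sum_pow_hits_le _ (Real.exp_pos _).le) (Real.exp_pos _).le
      _ = (n : ℝ) ^ n * Real.exp (K +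
          (Real.exp (-1) - 1) * ((∑ i, ((J q i).card : ℝ)) / n)) := by
          rw [Real.exp_add]; ring
      _ ≤ _ := by
          refine mul_le_mul_of_nonneg_left (Real.exp_le_exp.2 ?_) (by positivity)
          have he : Real.exp (-1) ≤ 1 / 2 := by
            rw [Real.exp_neg, ← one_div]
            exact one_div_le_one_div_of_le two_pos (by
              have := Real.add_one_le_exp 1
              linarith)
          nlinarith [hlow q, mul_le_mul_of_nonneg_right he
            ((mul_nonneg (by norm_num : (0 : ℝ) ≤ 4) hK).trans (hlow q))]
  have hright : ∀ q q', ∑ f : Fin n → Fin n, (if q = q' then (0 : ℝ) else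
      z ^ hits (fun i => J q i ∩ J q' i) f / z ^ (β + 1)) ≤
      (n : ℝ) ^ n * (Real.exp 1 / z ^ (β + 1)) := by
    intro q q'
    split_ifs with h
    · simp only [Finset.sum_const_zero]
      positivity
    · rw [← Finset.sum_div, ← mul_div_assoc]
      refine div_le_div_of_nonneg_right ?_ (by positivity)
      refine (sum_pow_hits_le _ hz0.le).trans
        (mul_le_mul_of_nonneg_left (Real.exp_le_exp.2 ?_) (by positivity))
      refine le_trans (mul_le_mul_of_nonneg_right (by linarith : z - 1 ≤ z) ?_) (hpair q q' h)
      positivity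
  rw [Finset.sum_add_distrib, Finset.sum_comm] at hsum
  have hswap : ∑ f : Fin n → Fin n, ∑ q, ∑ q', (if q = q' then (0 : ℝ) else
      z ^ hits (fun i => J q i ∩ J q' i) f / z ^ (β + 1)) =
      ∑ q, ∑ q', ∑ f : Fin n → Fin n, (if q = q' then (0 : ℝ) else
      z ^ hits (fun i => J q i ∩ J q' i) f / z ^ (β + 1)) := by
    rw [Finset.sum_comm]
    exact Finset.sum_congr rfl fun q _ => Finset.sum_comm
  rw [hswap] at hsum
  have h1 := Finset.sum_le_sum fun q (_ : q ∈ (Finset.univ : Finset ι)) => hleft q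
  have h2 := Finset.sum_le_sum fun q (_ : q ∈ (Finset.univ : Finset ι)) =>
    Finset.sum_le_sum fun q' (_ : q' ∈ (Finset.univ : Finset ι)) => hright q q'
  simp only [Finset.sum_const, Finset.card_univ, nsmul_eq_mul, Fintype.card_pi,
    Fintype.card_fin, Finset.prod_const, mul_one, Nat.cast_pow] at hsum h1 h2
  have hpos : (0 : ℝ) < (n : ℝ) ^ n := by positivity
  have := mul_lt_mul_of_pos_left hm hpos
  nlinarith [hsum, h1, h2, this]

/-! ### Counting grid values -/

lemma card_le_add_one_of_sub_le {n : ℕ} (S : Finset (Fin n)) {l : ℝ} (hl : 0 ≤ l)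
    (h : ∀ i ∈ S, ∀ j ∈ S, (i : ℝ) - j ≤ l) : (S.card : ℝ) ≤ l + 1 := by
  rcases S.eq_empty_or_nonempty with rfl | hne
  · simp only [Finset.card_empty, Nat.cast_zero]
    linarith
  have hsub : S ⊆ Finset.Icc (S.min' hne) (S.max' hne) := fun i hi =>
    Finset.mem_Icc.2 ⟨S.min'_le i hi, S.le_max' i hi⟩
  have h1 := Finset.card_le_card hsub
  rw [Fin.card_Icc] at h1
  have h2 := h _ (S.max'_mem hne) _ (S.min'_mem hne)
  have h3 : (S.min' hne : ℕ) ≤ S.max' hne := S.min'_le _ (S.max'_mem hne)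
  have h4 : S.card + (S.min' hne : ℕ) ≤ (S.max' hne : ℕ) + 1 := by omega
  have h5 : (S.card : ℝ) + (S.min' hne : ℕ) ≤ (S.max' hne : ℕ) + 1 := by exact_mod_cast h4
  linarith

lemma sub_one_le_card_of_Icc {n : ℕ} (S : Finset (Fin n)) {a b : ℝ} (ha : 0 ≤ a) (hab : a ≤ b)
    (hb : b < n) (h : ∀ i : Fin n, a ≤ i → (i : ℝ) ≤ b → i ∈ S) : b - a - 1 ≤ S.card := by
  have hsub : Finset.Icc ⌈a⌉₊ ⌊b⌋₊ ⊆ S.map Fin.valEmbedding := by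
    intro k hk
    rw [Finset.mem_Icc] at hk
    have hkb : (k : ℝ) ≤ b := (Nat.le_floor_iff (ha.trans hab)).1 hk.2
    have hkn : k < n := by exact_mod_cast hkb.trans_lt hb
    exact Finset.mem_map.2 ⟨⟨k, hkn⟩, h ⟨k, hkn⟩ (Nat.ceil_le.1 hk.1) hkb, rfl⟩
  have h1 := Finset.card_le_card hsub
  rw [Finset.card_map, Nat.card_Icc] at h1
  have h2 : ⌊b⌋₊ + 1 ≤ S.card + ⌈a⌉₊ := by omega
  have h3 : (⌊b⌋₊ : ℝ) + 1 ≤ S.card + ⌈a⌉₊ := by exact_mod_cast h2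
  have h4 := Nat.lt_floor_add_one b
  have h5 := Nat.ceil_lt_add_one ha
  linarith

/-- A quadratic polynomial with leading coefficient at least `1` is at most `h` in absolute value
only on two short intervals, one on each side of its vertex. -/
lemma card_le_of_abs_quadratic_le {n : ℕ} (S : Finset (Fin n)) {A B C h : ℝ} (hA : 1 ≤ A)
    (hS : ∀ i ∈ S, |A * ((i : ℝ) / n) ^ 2 + B * ((i : ℝ) / n) + C| ≤ h) :
    (S.card : ℝ) ≤ 2 * (n * √(2 * h) + 1) := by
  classical
  have key : ∀ T ⊆ S, (∀ i ∈ T, ∀ j ∈ T, 0 ≤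
      (2 * A * ((i : ℝ) / n) + B) * (2 * A * ((j : ℝ) / n) + B)) →
      (T.card : ℝ) ≤ n * √(2 * h) + 1 := by
    intro T hT hside
    refine card_le_add_one_of_sub_le T (by positivity) fun i hi j hj => ?_
    have hn : (0 : ℝ) < n := by exact_mod_cast i.pos
    have h1 := abs_le.1 (hS i (hT hi))
    have h2 := abs_le.1 (hS j (hT hj))
    have h3 := hside i hi j hj
    set x := (i : ℝ) / n with hx
    set y := (j : ℝ) / n with hy
    have hij : (i : ℝ) - j = n * (x - y) := by
      rw [hx, hy]; field_simp
    rw [hij]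
    refine mul_le_mul_of_nonneg_left (Real.le_sqrt_of_sq_le ?_) hn.le
    -- On one side of the vertex the values differ by at least `A * (x - y) ^ 2`.
    have h4 : A * (x - y) ^ 2 ≤ |A * x ^ 2 + B * x + C - (A * y ^ 2 + B * y + C)| := by
      have hfac : A * x ^ 2 + B * x + C - (A * y ^ 2 + B * y + C) =
          (x - y) * (((2 * A * x + B) + (2 * A * y + B)) / 2) := by ring
      have hd : A * (x - y) = ((2 * A * x + B) - (2 * A * y + B)) / 2 := by ring
      have habs : |A * (x - y)| ≤ |((2 * A * x + B) + (2 * A * y + B)) / 2| := by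
        rw [hd]
        refine sq_le_sq.1 ?_
        nlinarith
      rw [hfac, abs_mul]
      calc A * (x - y) ^ 2 = |A * (x - y) ^ 2| := (abs_of_nonneg (by positivity)).symm
        _ = |x - y| * |A * (x - y)| := by rw [← abs_mul]; ring_nf
        _ ≤ _ := mul_le_mul_of_nonneg_left habs (abs_nonneg _)
    have h5 : |A * x ^ 2 + B * x + C - (A * y ^ 2 + B * y + C)| ≤ 2 * h :=
      abs_le.2 ⟨by linarith, by linarith⟩
    nlinarith [sq_nonneg (x - y)]
  have h1 := key (S.filter fun i => 0 ≤ 2 * A * ((i : ℝ) / n) + B) (Finset.filter_subset _ _)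
    fun i hi j hj => mul_nonneg (Finset.mem_filter.1 hi).2 (Finset.mem_filter.1 hj).2
  have h2 := key (S.filter fun i => ¬ 0 ≤ 2 * A * ((i : ℝ) / n) + B) (Finset.filter_subset _ _)
    fun i hi j hj => mul_nonneg_of_nonpos_of_nonpos (not_le.1 (Finset.mem_filter.1 hi).2).le
      (not_le.1 (Finset.mem_filter.1 hj).2).le
  have h3 : (S.card : ℝ) = ((S.filter fun i : Fin n => 0 ≤ 2 * A * ((i : ℝ) / n) + B).card : ℝ) +
      ((S.filter fun i : Fin n => ¬ 0 ≤ 2 * A * ((i : ℝ) / n) + B).card : ℝ) := by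
    exact_mod_cast (Finset.card_filter_add_card_filter_not _).symm
  linarith

/-! ### Annuli as sublevel sets -/

/-- The defining function of the circle with center `(u, -V)` and squared radius
`s + u ^ 2 + V ^ 2`. Two such functions differ by an affine function. -/
def circleFun (u V s x y : ℝ) : ℝ := x ^ 2 + y ^ 2 - 2 * u * x + 2 * V * y - s

lemma mem_planarAnnulus_iff {u V s w x y : ℝ} (hw : w ≤ s) (hw0 : 0 ≤ w) :
    !₂[x, y] ∈ planarAnnulus !₂[u, -V] √(s + u ^ 2 + V ^ 2 - w) √(s + u ^ 2 + V ^ 2 + w) ↔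
      |circleFun u V s x y| ≤ w := by
  have hd : dist (!₂[x, y] : Plane) !₂[u, -V] = √(circleFun u V s x y + (s + u ^ 2 + V ^ 2)) := by
    rw [EuclideanSpace.dist_eq, Fin.sum_univ_two]
    congr 1
    simp only [Real.dist_eq, sq_abs, circleFun]
    simp
    ring
  have hnn : 0 ≤ circleFun u V s x y + (s + u ^ 2 + V ^ 2) := by
    unfold circleFun
    nlinarith [sq_nonneg (x - u), sq_nonneg (y + V)]
  rw [planarAnnulus, Set.mem_ofPred_eq, hd, Real.sqrt_le_sqrt_iff hnn,
    Real.sqrt_le_sqrt_iff (by nlinarith [sq_nonneg u, sq_nonneg V]), abs_le]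
  constructor <;> rintro ⟨h1, h2⟩ <;> constructor <;> linarith

/-- The heights `j` at which the grid point `(i / n, j / n)` lies in the given annulus. -/
noncomputable def column (n : ℕ) (u V s w : ℝ) (i : Fin n) : Finset (Fin n) :=
  Finset.univ.filter fun j => |circleFun u V s ((i : ℝ) / n) ((j : ℝ) / n)| ≤ w

lemma mem_column {n : ℕ} {u V s w : ℝ} {i j : Fin n} :
    j ∈ column n u V s w i ↔ |circleFun u V s ((i : ℝ) / n) ((j : ℝ) / n)| ≤ w := by
  simp [column]

lemma fin_div_mem {n : ℕ} (i : Fin n) : 0 ≤ (i : ℝ) / n ∧ (i : ℝ) / n ≤ 1 := by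
  have hi : (i : ℝ) ≤ n := by exact_mod_cast i.2.le
  exact ⟨by positivity, div_le_one_of_le₀ hi (Nat.cast_nonneg n)⟩

lemma card_column_le {n : ℕ} {u V s w : ℝ} (hV : 3 ≤ V) (hw : 2 ≤ n * w) (i : Fin n) :
    ((column n u V s w i).card : ℝ) ≤ n * w := by
  have hn : (0 : ℝ) < n := by exact_mod_cast i.pos
  suffices h : ((column n u V s w i).card : ℝ) ≤ n * w / 3 + 1 by linarith
  refine card_le_add_one_of_sub_le _ (by linarith) fun j hj k hk => ?_
  have h1 := abs_le.1 (mem_column.1 hj)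
  have h2 := abs_le.1 (mem_column.1 hk)
  have h3 := (fin_div_mem j).1
  have h4 := (fin_div_mem k).1
  unfold circleFun at h1 h2
  set x := (i : ℝ) / n
  set y := (j : ℝ) / n with hy
  set z := (k : ℝ) / n with hz
  have hjk : (j : ℝ) - k = n * (y - z) := by
    rw [hy, hz]; field_simp
  rw [hjk, mul_div_assoc]
  refine mul_le_mul_of_nonneg_left ?_ hn.le
  by_contra! hlt
  have hw0 : 0 < w := by
    by_contra! h
    nlinarith
  have h5 : (y - z) * (y + z + 2 * V) ≤ 2 * w := by nlinarith
  nlinarith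

/-- The circles cross every column inside the unit square, at a bounded slope. -/
lemma le_card_column {n : ℕ} {u V s w : ℝ} (hu : 0 ≤ u) (hu' : u ≤ 1) (hV : 3 ≤ V) (hV' : V ≤ 4)
    (hs : 2 ≤ s) (hs' : s ≤ 3) (hw0 : 0 ≤ w) (hw1 : w ≤ 1) (hw : 20 ≤ n * w) (i : Fin n) :
    n * w / 20 ≤ ((column n u V s w i).card : ℝ) := by
  have hn : (0 : ℝ) < n := by exact_mod_cast i.pos
  obtain ⟨hx0, hx1⟩ := fin_div_mem i
  set x := (i : ℝ) / n with hx
  set ρ := s + 2 * u * x - x ^ 2 with hρ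
  have hρ1 : 1 ≤ ρ := by nlinarith [mul_nonneg hu hx0]
  have hρ5 : ρ ≤ 5 := by nlinarith [mul_le_mul hu' hx1 hx0 zero_le_one]
  set y₀ := √(V ^ 2 + ρ) - V with hy₀
  have hsq : (y₀ + V) ^ 2 = V ^ 2 + ρ := by
    rw [hy₀, sub_add_cancel]
    exact Real.sq_sqrt (by positivity)
  have hy0 : 0 ≤ y₀ := by
    rw [hy₀, sub_nonneg]
    exact Real.le_sqrt_of_sq_le (by linarith)
  have hy1 : y₀ ≤ 5 / 6 := by nlinarith
  have key := sub_one_le_card_of_Icc (column n u V s w i) (a := n * y₀) (b := n * (y₀ + w / 10))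
    (by positivity) (mul_le_mul_of_nonneg_left (by linarith) hn.le) (by nlinarith)
    (fun j h1 h2 => by
      rw [mem_column, circleFun]
      have h1' : y₀ ≤ (j : ℝ) / n := by rw [le_div_iff₀ hn]; linarith
      have h2' : (j : ℝ) / n ≤ y₀ + w / 10 := by rw [div_le_iff₀ hn]; linarith
      set y := (j : ℝ) / n
      have hval : (i / n : ℝ) ^ 2 + y ^ 2 - 2 * u * (i / n) + 2 * V * y - s =
          (y - y₀) * (y + y₀ + 2 * V) := by
        rw [← hx]
        nlinarith
      rw [hval, abs_of_nonneg (mul_nonneg (by linarith) (by linarith))]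
      have h3 : (y - y₀) * (y + y₀ + 2 * V) ≤ w / 10 * 10 :=
        mul_le_mul (by linarith) (by linarith) (by linarith) (by linarith)
      linarith)
  linarith

/-! ### Pairs of annuli -/

/-- The columns in which two annuli have a common grid point. -/
def commonColumns {n : ℕ} (J J' : Fin n → Finset (Fin n)) : Finset (Fin n) :=
  Finset.univ.filter fun i => (J i ∩ J' i).Nonempty

lemma mem_commonColumns {n : ℕ} {u V s u' V' s' w : ℝ} {i : Fin n} :
    i ∈ commonColumns (column n u V s w) (column n u' V' s' w) ↔
      ∃ j : Fin n, |circleFun u V s ((i : ℝ) / n) ((j : ℝ) / n)| ≤ w ∧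
        |circleFun u' V' s' ((i : ℝ) / n) ((j : ℝ) / n)| ≤ w := by
  simp [commonColumns, Finset.Nonempty, mem_column]

lemma sum_card_inter_le {n : ℕ} {J J' : Fin n → Finset (Fin n)} {M : ℝ}
    (hJ : ∀ i, ((J i).card : ℝ) ≤ M) :
    ∑ i, ((J i ∩ J' i).card : ℝ) ≤ (commonColumns J J').card * M := by
  rw [← nsmul_eq_mul, ← Finset.sum_const, commonColumns, Finset.sum_filter]
  refine Finset.sum_le_sum fun i _ => ?_
  split_ifs with h
  · exact le_trans (by exact_mod_cast Finset.card_le_card Finset.inter_subset_left) (hJ i)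
  · rw [Finset.not_nonempty_iff_eq_empty.1 h]
    simp

lemma commonColumns_eq_empty {n : ℕ} {u V s s' w : ℝ} (hs : 2 * w < |s - s'|) :
    commonColumns (column n u V s w) (column n u V s' w) = ∅ := by
  refine Finset.eq_empty_of_forall_notMem fun i hi => ?_
  obtain ⟨j, h1, h2⟩ := mem_commonColumns.1 hi
  have h3 := (abs_sub _ _).trans (add_le_add h2 h1)
  have h4 : circleFun u V s' ((i : ℝ) / n) ((j : ℝ) / n) -
      circleFun u V s ((i : ℝ) / n) ((j : ℝ) / n) = s - s' := by
    unfold circleFun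
    ring
  rw [h4] at h3
  linarith

/-- If the centers differ only horizontally, then the common points of two annuli lie in a narrow
vertical strip. -/
lemma card_commonColumns_le_of_horizontal {n : ℕ} {u u' V s s' w d : ℝ} (hw : 0 ≤ w) (hd : 0 < d)
    (hu : d ≤ |u - u'|) :
    ((commonColumns (column n u V s w) (column n u' V s' w)).card : ℝ) ≤ 2 * w * n / d + 1 := by
  refine card_le_add_one_of_sub_le _ (by positivity) fun i hi k hk => ?_
  have hn : (0 : ℝ) < n := by exact_mod_cast i.pos
  obtain ⟨j, h1, h2⟩ := mem_commonColumns.1 hi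
  obtain ⟨l, h3, h4⟩ := mem_commonColumns.1 hk
  unfold circleFun at h1 h2 h3 h4
  rw [abs_le] at h1 h2 h3 h4
  set x := (i : ℝ) / n with hx
  set y := (k : ℝ) / n with hy
  have hik : (i : ℝ) - k = n * (x - y) := by
    rw [hx, hy]; field_simp
  have h5 : |(u - u') * (x - y)| ≤ 2 * w := abs_le.2 ⟨by nlinarith, by nlinarith⟩
  rw [abs_mul] at h5
  have h6 : d * (x - y) ≤ 2 * w :=
    (mul_le_mul_of_nonneg_left (le_abs_self _) hd.le).trans
      ((mul_le_mul_of_nonneg_right hu (abs_nonneg _)).trans h5)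
  rw [hik, le_div_iff₀ hd]
  nlinarith

/-- If the centers differ vertically, then the common points of two annuli lie in a narrow strip
around a line that is not vertical. Restricted to this line the function of a circle is quadratic,
so that even in the worst case of tangency the strip leaves the annulus after a short while. -/
lemma card_commonColumns_le_of_vertical {n : ℕ} {u u' V V' s s' w d : ℝ} (hw : 0 < w) (hd : 0 < d)
    (hd1 : d ≤ 1) (hwd : w ≤ d) (hV0 : 0 ≤ V) (hV4 : V ≤ 4) (hV : d ≤ |V - V'|) :
    ((commonColumns (column n u V s w) (column n u' V' s' w)).card : ℝ) ≤
      2 * (n * √(2 * (12 * (w / d))) + 1) := by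
  have hD0 : V - V' ≠ 0 := fun h => by
    rw [h, abs_zero] at hV
    linarith
  set κ := w / d with hκ
  have hκ1 : κ ≤ 1 := div_le_one_of_le₀ hwd hd.le
  have hκ0 : 0 < κ := div_pos hw hd
  have hwκ : w ≤ κ := (le_div_iff₀ hd).2 (by nlinarith)
  set α := (u - u') / (V - V') with hα
  set γ := (s - s') / (2 * (V - V')) with hγ
  refine card_le_of_abs_quadratic_le _ (A := 1 + α ^ 2)
    (B := 2 * α * γ - 2 * u + 2 * V * α) (C := γ ^ 2 + 2 * V * γ - s)
    (by nlinarith [sq_nonneg α]) fun i hi => ?_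
  obtain ⟨j, h1, h2⟩ := mem_commonColumns.1 hi
  obtain ⟨hy0, hy1⟩ := fin_div_mem j
  set x := (i : ℝ) / n
  set y := (j : ℝ) / n
  set e := y - (α * x + γ) with he
  have hdiff : circleFun u V s x y - circleFun u' V' s' x y = 2 * ((V - V') * e) := by
    have h3 : (V - V') * e = (V - V') * y - ((u - u') * x + (s - s') / 2) := by
      rw [he, hα, hγ]
      field_simp
    rw [h3]
    unfold circleFun
    ring
  have h3 : |(V - V') * e| ≤ w := by
    have := (abs_sub _ _).trans (add_le_add h1 h2)
    rw [hdiff, abs_mul, abs_two] at this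
    linarith
  have h4 : |e| ≤ κ := by
    rw [hκ, le_div_iff₀ hd, mul_comm]
    rw [abs_mul] at h3
    exact (mul_le_mul_of_nonneg_right hV (abs_nonneg _)).trans h3
  have h5 := abs_le.1 h4
  have h6 : |e * (2 * y - e + 2 * V)| ≤ κ * 11 := by
    rw [abs_mul]
    exact mul_le_mul h4 (abs_le.2 ⟨by linarith, by linarith⟩) (abs_nonneg _) hκ0.le
  have h7 : (1 + α ^ 2) * x ^ 2 + (2 * α * γ - 2 * u + 2 * V * α) * x +
      (γ ^ 2 + 2 * V * γ - s) = circleFun u V s x y - e * (2 * y - e + 2 * V) := by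
    rw [he]
    unfold circleFun
    ring
  rw [h7]
  have := abs_sub (circleFun u V s x y) (e * (2 * y - e + 2 * V))
  linarith

/-! ### A hard configuration -/

/-- The point set with one point in every column, at the heights given by `f`. -/
noncomputable def gridPoint {n : ℕ} (f : Fin n → Fin n) : Fin n ↪ Plane where
  toFun i := !₂[(i : ℝ) / n, (f i : ℝ) / n]
  inj' i j h := by
    have hn : (n : ℝ) ≠ 0 := by exact_mod_cast i.pos.ne'
    have h0 := congrArg (fun p : Plane => p 0) h
    simp only [Matrix.cons_val_zero] at h0
    exact Fin.ext (by exact_mod_cast (div_left_inj' hn).1 h0)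

lemma pointsIn_map_gridPoint {n : ℕ} (f : Fin n → Fin n) {u V s w : ℝ} (hw0 : 0 ≤ w)
    (hw : w ≤ s) :
    pointsIn (Finset.univ.map (gridPoint f))
      (planarAnnulus !₂[u, -V] √(s + u ^ 2 + V ^ 2 - w) √(s + u ^ 2 + V ^ 2 + w)) =
      (Finset.univ.filter fun i => f i ∈ column n u V s w i).map (gridPoint f) := by
  classical
  rw [pointsIn, Finset.filter_map]
  congr 1
  ext i
  simp only [Finset.mem_filter, Finset.mem_univ, true_and, Function.comp_apply, mem_column]
  exact mem_planarAnnulus_iff hw hw0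

lemma one_le_floor_add_one_mul {d : ℝ} (hd : 0 < d) : 1 ≤ ((⌊1 / d⌋₊ + 1 : ℕ) : ℝ) * d := by
  rw [← div_le_iff₀ hd]
  push_cast
  exact (Nat.lt_floor_add_one _).le

lemma fin_floor_mul_le_one {d : ℝ} (hd : 0 < d) (k : Fin (⌊1 / d⌋₊ + 1)) : (k : ℝ) * d ≤ 1 := by
  rw [← le_div_iff₀ hd]
  exact (Nat.le_floor_iff (by positivity)).1 (Nat.lt_succ_iff.1 k.2)

lemma le_abs_fin_mul_sub {d : ℝ} (hd : 0 < d) {N : ℕ} {k l : Fin N} (h : k ≠ l) :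
    d ≤ |(k : ℝ) * d - l * d| := by
  rw [← sub_mul, abs_mul, abs_of_pos hd]
  refine le_mul_of_one_le_left hd.le ?_
  have h1 : ((k : ℕ) : ℤ) - (l : ℕ) ≠ 0 := by
    have := Fin.val_ne_of_ne h
    omega
  exact_mod_cast Int.one_le_abs h1

lemma floor_add_one_le {n : ℕ} {d t : ℝ} (hn : 2 ≤ n) (ht : 2 ≤ t) (hd : d = t / n) :
    ((⌊1 / d⌋₊ + 1 : ℕ) : ℝ) ≤ n := by
  have hn' : (2 : ℝ) ≤ n := by exact_mod_cast hn
  have h1 : 1 / d ≤ n / 2 := by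
    rw [hd, one_div_div]
    exact div_le_div_of_nonneg_left (by linarith) two_pos ht
  have h2 : (⌊1 / d⌋₊ : ℝ) ≤ 1 / d := Nat.floor_le (by rw [hd]; positivity)
  push_cast
  linarith

/-- The annuli of a hard configuration have width about `w = W / n`, and their centers and radii
form a grid whose steps in the vertical and horizontal coordinates of the center and in the squared
radius are `24 * W ^ 3 * θ ^ 2 / n`, `2 * W ^ 2 * θ / n` and `3 * W / n`. Up to constants these are
the smallest steps for which any two annuli share points only in `O(n / (W * θ))` columns. -/
theorem exists_separated_annuli {n : ℕ} {W θ : ℝ} (hW : 80 ≤ W) (hθ : 4 ≤ θ)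
    (hWθ : W * θ ≤ n) :
    ∃ (m : ℕ) (u V s : Fin m → ℝ), (m : ℝ) ≤ (n : ℝ) ^ 3 ∧
      (n : ℝ) ^ 3 ≤ 144 * W ^ 6 * θ ^ 3 * m ∧
      (∀ q, 0 ≤ u q ∧ u q ≤ 1 ∧ 3 ≤ V q ∧ V q ≤ 4 ∧ 2 ≤ s q ∧ s q ≤ 3) ∧
      ∀ q q', q ≠ q' →
        (commonColumns (column n (u q) (V q) (s q) (W / n))
          (column n (u q') (V q') (s q') (W / n))).card * (W / n) ≤ 4 / θ := by
  have hn320 : (320 : ℝ) ≤ n := by nlinarith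
  have hn : (0 : ℝ) < n := by linarith
  have hn2 : 2 ≤ n := by
    have : (2 : ℝ) ≤ n := by linarith
    exact_mod_cast this
  have hW0 : 0 < W := by linarith
  have hθ0 : 0 < θ := by linarith
  set w := W / n with hw
  have hw0 : 0 < w := by positivity
  set du := 2 * W ^ 2 * θ / n with hdu
  set dv := 24 * W ^ 3 * θ ^ 2 / n with hdv
  set ds := 3 * W / n with hds
  have hdu0 : 0 < du := by positivity
  have hdv0 : 0 < dv := by positivity
  have hds0 : 0 < ds := by positivity
  set Nu := ⌊1 / du⌋₊ + 1 with hNu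
  set Nv := ⌊1 / dv⌋₊ + 1 with hNv
  set Ns := ⌊1 / ds⌋₊ + 1 with hNs
  let ι := Fin Nu × Fin Nv × Fin Ns
  let u : ι → ℝ := fun q => q.1 * du
  let V : ι → ℝ := fun q => 3 + q.2.1 * dv
  let s : ι → ℝ := fun q => 2 + q.2.2 * ds
  have hu0 : ∀ q, 0 ≤ u q := fun q => by positivity
  have hu1 : ∀ q, u q ≤ 1 := fun q => fin_floor_mul_le_one hdu0 q.1
  have hV0 : ∀ q, 3 ≤ V q := fun q => le_add_of_nonneg_right (by positivity)
  have hV1 : ∀ q, V q ≤ 4 := fun q => by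
    have := fin_floor_mul_le_one hdv0 q.2.1
    simp only [V]
    linarith
  have hs0 : ∀ q, 2 ≤ s q := fun q => le_add_of_nonneg_right (by positivity)
  have hs1 : ∀ q, s q ≤ 3 := fun q => by
    have := fin_floor_mul_le_one hds0 q.2.2
    simp only [s]
    linarith
  have hcard : (Fintype.card ι : ℝ) = Nu * (Nv * Ns) := by
    simp [ι]
  have hcard_le : (Fintype.card ι : ℝ) ≤ (n : ℝ) ^ 3 := by
    have h1 : (Nu : ℝ) ≤ n := floor_add_one_le hn2 (by nlinarith) hdu
    have h2 : (Nv : ℝ) ≤ n := by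
      refine floor_add_one_le hn2 ?_ hdv
      have h3 : (1 : ℝ) ≤ W ^ 3 := one_le_pow₀ (by linarith)
      have h4 : (1 : ℝ) ≤ θ ^ 2 := one_le_pow₀ (by linarith)
      nlinarith
    have h3 : (Ns : ℝ) ≤ n := floor_add_one_le hn2 (by linarith) hds
    calc (Fintype.card ι : ℝ) = Nu * (Nv * Ns) := hcard
      _ ≤ n * (n * n) := by gcongr
      _ = (n : ℝ) ^ 3 := by ring
  have hcard_ge : (n : ℝ) ^ 3 ≤ 144 * W ^ 6 * θ ^ 3 * Fintype.card ι := by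
    have h1 := one_le_floor_add_one_mul hdu0
    have h2 := one_le_floor_add_one_mul hdv0
    have h3 := one_le_floor_add_one_mul hds0
    have h4 : (1 : ℝ) ≤ (Nu * du) * ((Nv * dv) * (Ns * ds)) :=
      one_le_mul_of_one_le_of_one_le h1 (one_le_mul_of_one_le_of_one_le h2 h3)
    have h5 : (Nu * du) * ((Nv * dv) * (Ns * ds)) =
        144 * W ^ 6 * θ ^ 3 * Fintype.card ι / (n : ℝ) ^ 3 := by
      rw [hcard, hdu, hdv, hds]
      field_simp
      ring
    rwa [h5, one_le_div (by positivity)] at h4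
  have hcommon : ∀ q q', q ≠ q' →
      (commonColumns (column n (u q) (V q) (s q) w)
        (column n (u q') (V q') (s q') w)).card * w ≤ 4 / θ := by
    intro q q' hne
    have hwθ : w ≤ 1 / θ := by
      rw [hw, div_le_div_iff₀ hn hθ0]
      linarith
    by_cases hv : q.2.1 = q'.2.1
    · have hVV : V q = V q' := by simp only [V, hv]
      by_cases hu : q.1 = q'.1
      · have huu : u q = u q' := by simp only [u, hu]
        have hsne : q.2.2 ≠ q'.2.2 := fun hs => hne (Prod.ext hu (Prod.ext hv hs))
        have h1 : 2 * w < |s q - s q'| := by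
          have h2 := le_abs_fin_mul_sub hds0 hsne
          have h3 : s q - s q' = q.2.2 * ds - q'.2.2 * ds := by simp only [s]; ring
          have h4 : ds = 3 * w := by rw [hds, hw]; ring
          rw [h3]
          linarith
        have h2 : commonColumns (column n (u q) (V q) (s q) w)
            (column n (u q') (V q') (s q') w) = ∅ := by
          rw [hVV, huu]
          exact commonColumns_eq_empty h1
        rw [h2, Finset.card_empty, Nat.cast_zero, zero_mul]
        positivity
      · have h1 : ((commonColumns (column n (u q) (V q) (s q) w)
            (column n (u q') (V q') (s q') w)).card : ℝ) ≤ 2 * w * n / du + 1 := by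
          rw [hVV]
          exact card_commonColumns_le_of_horizontal hw0.le hdu0 (le_abs_fin_mul_sub hdu0 hu)
        have h2 : 2 * w * n / du * w = 1 / θ := by
          rw [hdu, hw]
          field_simp
        calc (commonColumns (column n (u q) (V q) (s q) w)
              (column n (u q') (V q') (s q') w)).card * w
            ≤ (2 * w * n / du + 1) * w :=
              mul_le_mul_of_nonneg_right h1 hw0.le
          _ = 1 / θ + w := by rw [add_mul, h2, one_mul]
          _ ≤ 4 / θ := by
              have : 4 / θ = 1 / θ + 3 * (1 / θ) := by ring
              have : 0 < 1 / θ := by positivity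
              linarith
    · have hdV : dv ≤ |V q - V q'| := by
        have h3 : V q - V q' = q.2.1 * dv - q'.2.1 * dv := by simp only [V]; ring
        rw [h3]
        exact le_abs_fin_mul_sub hdv0 hv
      have hdv1 : dv ≤ 1 := hdV.trans (abs_le.2
        ⟨by linarith [hV0 q, hV1 q'], by linarith [hV0 q', hV1 q]⟩)
      have hratio : 2 * (12 * (w / dv)) = (1 / (W * θ)) ^ 2 := by
        rw [hw, hdv]
        field_simp
        norm_num
      have hwd : w ≤ dv := by
        rw [hw, hdv]
        refine div_le_div_of_nonneg_right ?_ hn.le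
        have h3 : (1 : ℝ) ≤ W ^ 2 := one_le_pow₀ (by linarith)
        have h4 : (1 : ℝ) ≤ θ ^ 2 := one_le_pow₀ (by linarith)
        have h5 : (1 : ℝ) ≤ W ^ 2 * θ ^ 2 := one_le_mul_of_one_le_of_one_le h3 h4
        have h6 : 24 * W ^ 3 * θ ^ 2 = 24 * W * (W ^ 2 * θ ^ 2) := by ring
        rw [h6]
        nlinarith
      have h1 := card_commonColumns_le_of_vertical (n := n) (u := u q) (u' := u q') (s := s q)
        (s' := s q') hw0 hdv0 hdv1 hwd (by linarith [hV0 q]) (hV1 q) hdV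
      rw [hratio, Real.sqrt_sq (by positivity)] at h1
      calc (commonColumns (column n (u q) (V q) (s q) w)
            (column n (u q') (V q') (s q') w)).card * w
          ≤ 2 * (n * (1 / (W * θ)) + 1) * w :=
            mul_le_mul_of_nonneg_right h1 hw0.le
        _ = 2 * (1 / θ) + 2 * w := by
            rw [hw]
            field_simp
        _ ≤ 4 / θ := by
            have : 4 / θ = 4 * (1 / θ) := by ring
            linarith
  have e := (Fintype.equivFin ι).symm
  exact ⟨Fintype.card ι, fun k => u (e k), fun k => V (e k), fun k => s (e k), hcard_le, hcard_ge,
    fun k => ⟨hu0 _, hu1 _, hV0 _, hV1 _, hs0 _, hs1 _⟩,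
    fun k l hkl => hcommon _ _ (e.injective.ne hkl)⟩

/-- There are `n` points and `n ^ 3 / (144 * W ^ 6 * θ ^ 3)` annuli such that every annulus contains
at least `W / 80` points and any two annuli share at most `β` points: with one random point in
every column, any two annuli expect only `O(1 / θ)` common points. -/
theorem exists_hard_configuration {n β : ℕ} {W θ : ℝ} (hW : 80 ≤ W) (hθ : 4 ≤ θ)
    (hWθ : W * θ ≤ n)
    (hsmall : (n : ℝ) ^ 3 * Real.exp (-(W / 80)) +
      ((n : ℝ) ^ 3) ^ 2 * (Real.exp 1 / (θ / 4) ^ (β + 1)) < 1) :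
    ∃ (P : Finset Plane) (m : ℕ) (c : Fin m → Plane) (r R : Fin m → ℝ), P.card = n ∧
      (n : ℝ) ^ 3 ≤ 144 * W ^ 6 * θ ^ 3 * m ∧
      (∀ q, 0 < r q ∧ r q < R q ∧
        W / 80 ≤ (pointsIn P (planarAnnulus (c q) (r q) (R q))).card) ∧
      ∀ q q', q ≠ q' → ∀ B : Finset Plane, B ⊆ pointsIn P (planarAnnulus (c q) (r q) (R q)) →
        B ⊆ pointsIn P (planarAnnulus (c q') (r q') (R q')) → B.card ≤ β := by
  have hn : (0 : ℝ) < n := by nlinarith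
  have hn0 : 0 < n := by exact_mod_cast hn
  have hθ0 : 0 < θ := by linarith
  obtain ⟨m, u, V, s, hm, hm', hq, hcommon⟩ := exists_separated_annuli hW hθ hWθ
  set w := W / n with hw
  have hw0 : 0 < w := by positivity
  have hnw : n * w = W := by rw [hw]; field_simp
  have hw1 : w ≤ 1 := by
    rw [hw, div_le_one hn]
    nlinarith
  have hws : ∀ q, w ≤ s q := fun q => hw1.trans (one_le_two.trans (hq q).2.2.2.2.1)
  have hnw20 : 20 ≤ n * w := by linarith
  obtain ⟨f, hf, hf'⟩ := exists_hits_and_common_hits_le hn0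
    (fun q => column n (u q) (V q) (s q) w) (K := W / 80) (z := θ / 4) (β := β) (by linarith)
    (fun q => by
      obtain ⟨hu0, hu1, hV0, hV1, hs0, hs1⟩ := hq q
      rw [le_div_iff₀ hn]
      have h1 := Finset.sum_le_sum fun i (_ : i ∈ (Finset.univ : Finset (Fin n))) =>
        le_card_column hu0 hu1 hV0 hV1 hs0 hs1 hw0.le hw1 hnw20 i
      rw [Finset.sum_const, Finset.card_univ, Fintype.card_fin, nsmul_eq_mul, hnw] at h1
      calc 4 * (W / 80) * n = n * (W / 20) := by ring
        _ ≤ _ := h1)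
    (fun q q' hne => by
      have h1 := sum_card_inter_le (J := column n (u q) (V q) (s q) w)
        (J' := column n (u q') (V q') (s q') w)
        (fun i => card_column_le (hq q).2.2.1 (by linarith) i)
      have h2 := (div_le_iff₀ hn).2 (h1.trans_eq (by ring :
        _ = ((commonColumns (column n (u q) (V q) (s q) w)
          (column n (u q') (V q') (s q') w)).card * w) * n))
      calc _ ≤ θ / 4 * (4 / θ) :=
            mul_le_mul_of_nonneg_left (h2.trans (hcommon q q' hne)) (by positivity)
        _ = 1 := by field_simp)
    (by positivity)
    (by
      rw [Fintype.card_fin]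
      refine lt_of_le_of_lt ?_ hsmall
      gcongr)
  refine ⟨Finset.univ.map (gridPoint f), m, fun q => !₂[u q, -V q],
    fun q => √(s q + u q ^ 2 + V q ^ 2 - w), fun q => √(s q + u q ^ 2 + V q ^ 2 + w),
    by simp, hm', fun q => ?_, fun q q' hne B hB hB' => ?_⟩
  · have hpos : 0 < s q + u q ^ 2 + V q ^ 2 - w := by
      nlinarith [sq_nonneg (u q), (hq q).2.2.1, hws q]
    refine ⟨Real.sqrt_pos.2 hpos, Real.sqrt_lt_sqrt hpos.le (by linarith), ?_⟩
    rw [pointsIn_map_gridPoint f hw0.le (hws q), Finset.card_map]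
    exact hf q
  · rw [pointsIn_map_gridPoint f hw0.le (hws q)] at hB
    rw [pointsIn_map_gridPoint f hw0.le (hws q')] at hB'
    refine le_trans ?_ (hf' q q' hne)
    rw [hits, ← Finset.card_map (gridPoint f)]
    refine Finset.card_le_card fun x hx => ?_
    obtain ⟨i, hi, rfl⟩ := Finset.mem_map.1 (hB hx)
    have hi' := (Finset.mem_map' _).1 (hB' hx)
    refine Finset.mem_map_of_mem _ ?_
    rw [Finset.mem_filter] at hi hi' ⊢
    exact ⟨hi.1, Finset.mem_inter.2 ⟨hi.2, hi'.2⟩⟩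

/-! ### Space lower bounds -/

lemma SolvesAnnulusReporting.mono {D : (P : Finset Plane) → PointerStructure P} {Q Q' : ℕ → ℝ}
    {C : ℝ} (h : SolvesAnnulusReporting D Q C) (hQ : ∀ n, Q n ≤ Q' n) :
    SolvesAnnulusReporting D Q' C := by
  intro P c r R hr hrR
  obtain ⟨W, h1, h2, h3⟩ := h P c r R hr hrR
  exact ⟨W, h1, h2, h3.trans (by linarith [hQ P.card])⟩

lemma SolvesAnnulusReporting.one_le_space {D : (P : Finset Plane) → PointerStructure P}
    {Q S : ℕ → ℝ} {C : ℝ} (h : SolvesAnnulusReporting D Q C) (hS : UsesSpace D S) {n : ℕ}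
    (hn : 0 < n) : 1 ≤ S n := by
  set P := Finset.univ.map (gridPoint (id : Fin n → Fin n)) with hP
  have hcard : P.card = n := by simp [hP]
  set x : Plane := gridPoint id ⟨0, hn⟩
  have hx : x ∈ P := Finset.mem_map_of_mem _ (Finset.mem_univ _)
  obtain ⟨W, -, hW, -⟩ := h P (x + EuclideanSpace.single 0 1) (1 / 2) 2 (by norm_num) (by norm_num)
  obtain ⟨v, -, -⟩ := hW x (by
    refine (@Finset.mem_filter _ _ (_) _ _).2 ⟨hx, ?_⟩
    constructor
    · simp
      norm_num
    · simp)
  have h1 : 1 ≤ (D P).size := v.pos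
  have h2 := hS P
  rw [hcard] at h2
  exact le_trans (by exact_mod_cast h1) h2

lemma tendsto_natCast_rpow_atTop {δ : ℝ} (hδ : 0 < δ) :
    Tendsto (fun n : ℕ => (n : ℝ) ^ δ) atTop atTop :=
  (tendsto_rpow_atTop hδ).comp tendsto_natCast_atTop_atTop

/-- The failure probability in the choice of the points tends to zero. -/
lemma eventually_failure_lt_one {δ : ℝ} (hδ : 0 < δ) {β : ℕ} (hβ : 7 ≤ δ * (β + 1)) :
    ∀ᶠ n : ℕ in atTop, (n : ℝ) ^ 3 * Real.exp (-(n : ℝ) ^ δ) +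
      ((n : ℝ) ^ 3) ^ 2 * (Real.exp 1 / ((n : ℝ) ^ δ / 4) ^ (β + 1)) < 1 := by
  have h1 : Tendsto (fun n : ℕ => ((n : ℝ) ^ δ) ^ (3 / δ) * Real.exp (-1 * (n : ℝ) ^ δ)) atTop
      (𝓝 0) :=
    (tendsto_rpow_mul_exp_neg_mul_atTop_nhds_zero (3 / δ) 1 one_pos).comp
      (tendsto_natCast_rpow_atTop hδ)
  have h2 : Tendsto (fun n : ℕ => Real.exp 1 * 4 ^ (β + 1) / (n : ℝ)) atTop (𝓝 0) :=
    tendsto_const_div_atTop_nhds_zero_nat _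
  filter_upwards [h1.eventually_lt_const (by norm_num : (0 : ℝ) < 1 / 2),
    h2.eventually_lt_const (by norm_num : (0 : ℝ) < 1 / 2), eventually_ge_atTop 1] with n h3 h4 hn
  have hn1 : (1 : ℝ) ≤ n := by exact_mod_cast hn
  have hn0 : (0 : ℝ) < n := by linarith
  have h5 : ((n : ℝ) ^ δ) ^ (3 / δ) = (n : ℝ) ^ 3 := by
    rw [← Real.rpow_mul hn0.le, mul_div_cancel₀ _ hδ.ne']
    exact_mod_cast Real.rpow_natCast (n : ℝ) 3
  rw [h5, neg_one_mul] at h3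
  have h6 : (n : ℝ) ^ 7 ≤ ((n : ℝ) ^ δ) ^ (β + 1) := by
    rw [← Real.rpow_natCast, ← Real.rpow_natCast, ← Real.rpow_mul hn0.le]
    refine Real.rpow_le_rpow_of_exponent_le hn1 ?_
    push_cast
    linarith
  have h7 : ((n : ℝ) ^ 3) ^ 2 * (Real.exp 1 / ((n : ℝ) ^ δ / 4) ^ (β + 1)) ≤
      Real.exp 1 * 4 ^ (β + 1) / (n : ℝ) := by
    rw [div_pow]
    calc ((n : ℝ) ^ 3) ^ 2 * (Real.exp 1 / (((n : ℝ) ^ δ) ^ (β + 1) / 4 ^ (β + 1)))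
        = (n : ℝ) ^ 6 * (Real.exp 1 * 4 ^ (β + 1)) / ((n : ℝ) ^ δ) ^ (β + 1) := by
          field_simp
      _ ≤ (n : ℝ) ^ 6 * (Real.exp 1 * 4 ^ (β + 1)) / (n : ℝ) ^ 7 :=
          div_le_div_of_nonneg_left (by positivity) (by positivity) h6
      _ = Real.exp 1 * 4 ^ (β + 1) / (n : ℝ) := by
          field_simp
  linarith

/-- The lower bound in terms of the slack `θ`, which is a small power of `n` in the application. -/
lemma cube_le_mul_space {D : (P : Finset Plane) → PointerStructure P} {Q S : ℕ → ℝ} {C : ℝ}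
    (hD : SolvesAnnulusReporting D Q C) (hS : UsesSpace D S) {n β γ L : ℕ} {θ : ℝ}
    (hQ : 1 ≤ Q n) (hγ : 1 + C ≤ γ) (hL : L = γ * β + 1) (hθ : 4 ≤ θ)
    (hθL : (2 : ℝ) ^ (L + 1) * (L + 1) ≤ θ) (hn : 80 * Q n * θ * θ ≤ n)
    (hsmall : (n : ℝ) ^ 3 * Real.exp (-θ) +
      ((n : ℝ) ^ 3) ^ 2 * (Real.exp 1 / (θ / 4) ^ (β + 1)) < 1) :
    (n : ℝ) ^ 3 ≤ 144 * 80 ^ 6 * (2 ^ (L + 1) * 2 ^ 2 ^ (L + 1)) * Q n ^ 5 * θ ^ 8 * S n := by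
  classical
  have hθ0 : 0 < θ := by linarith
  have hQ0 : 0 < Q n := by linarith
  have hQθ : Q n ≤ Q n * θ := le_mul_of_one_le_right hQ0.le (by linarith)
  have hθQ : θ ≤ Q n * θ := le_mul_of_one_le_left hθ0.le hQ
  -- Every annulus then contains at least `W / 80 = Q n * θ` points, which covers the query time.
  obtain ⟨P, m, c, r, R, hP, hm, hq, hpair⟩ :=
    exists_hard_configuration (n := n) (β := β) (W := 80 * Q n * θ) (by nlinarith) hθ hn (by
      refine lt_of_le_of_lt ?_ hsmall
      gcongr
      linarith)
  have hlow : ∀ q, Q n * θ ≤ (pointsIn P (planarAnnulus (c q) (r q) (R q))).card := fun q => by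
    have := (hq q).2.2
    linarith
  have key := (D P).card_mul_le_size
    (fun q : Fin m => pointsIn P (planarAnnulus (c q) (r q) (R q))) (β := β) (γ := γ) (L := L)
    (K := ⌈Q n * θ⌉₊)
    (fun q => by
      obtain ⟨W, h1, h2, h3⟩ := hD P (c q) (r q) (R q) (hq q).1 (hq q).2.1
      refine ⟨W, h1, h2, h3.trans ?_⟩
      rw [hP]
      nlinarith [hlow q])
    (fun q q' hne => by
      refine le_trans (le_of_eq ?_)
        (hpair q q' hne _ Finset.inter_subset_left Finset.inter_subset_right)
      congr)
    hL (fun q => Nat.ceil_le.2 (hlow q))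
    (by
      have h1 := (hθL.trans hθQ).trans (Nat.le_ceil (Q n * θ))
      exact_mod_cast h1)
  rw [Fintype.card_fin] at key
  set H : ℝ := 2 ^ (L + 1) * 2 ^ 2 ^ (L + 1) with hH
  have hH0 : 0 < H := by positivity
  have hsize : ((D P).size : ℝ) ≤ S n := hP ▸ hS P
  have key' : (m : ℝ) * (Q n * θ) ≤ H * S n := by
    have h1 : (m : ℝ) * (⌈Q n * θ⌉₊ : ℝ) ≤ H * (D P).size := by
      rw [hH]
      exact_mod_cast key
    exact (mul_le_mul_of_nonneg_left (Nat.le_ceil _) (Nat.cast_nonneg m)).trans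
      (h1.trans (mul_le_mul_of_nonneg_left hsize hH0.le))
  calc (n : ℝ) ^ 3 ≤ 144 * (80 * Q n * θ) ^ 6 * θ ^ 3 * m := hm
    _ = 144 * 80 ^ 6 * Q n ^ 5 * θ ^ 8 * (m * (Q n * θ)) := by ring
    _ ≤ 144 * 80 ^ 6 * Q n ^ 5 * θ ^ 8 * (H * S n) :=
        mul_le_mul_of_nonneg_left key' (by positivity)
    _ = _ := by ring

/-- The lower bound with a fixed loss `ε` in the exponent, for all `n` from a point on that does
not depend on the data structure. -/
theorem eventually_rpow_div_le_space (C : ℝ) {ε : ℝ} (hε : 0 < ε) :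
    ∀ᶠ n : ℕ in atTop, ∀ (Q S : ℕ → ℝ) (D : (P : Finset Plane) → PointerStructure P),
      (∀ n, 1 ≤ Q n) → SolvesAnnulusReporting D Q C → UsesSpace D S →
        (n : ℝ) ^ (3 - ε) / Q n ^ 5 ≤ S n := by
  obtain ⟨δ, hδ, rfl⟩ : ∃ δ : ℝ, 0 < δ ∧ ε = 10 * δ := ⟨ε / 10, by positivity, by ring⟩
  obtain ⟨β, hβ⟩ := exists_nat_ge (7 / δ)
  obtain ⟨γ, hγ⟩ := exists_nat_ge (1 + C)
  obtain ⟨L, hL⟩ : ∃ L, L = γ * β + 1 := ⟨_, rfl⟩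
  have hβ' : 7 ≤ δ * (β + 1) := by
    rw [div_le_iff₀ hδ] at hβ
    nlinarith
  have hθ := tendsto_natCast_rpow_atTop hδ
  filter_upwards [eventually_failure_lt_one hδ hβ', hθ.eventually_ge_atTop 4,
    hθ.eventually_ge_atTop ((2 : ℝ) ^ (L + 1) * (L + 1)),
    hθ.eventually_ge_atTop (144 * 80 ^ 6 * (2 ^ (L + 1) * 2 ^ 2 ^ (L + 1))),
    tendsto_natCast_atTop_atTop.eventually_ge_atTop ((80 : ℝ) ^ 5)]
    with n hsmall hθ4 hθL hθH hn80 Q S D hQ hD hS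
  have hn1 : (1 : ℝ) ≤ n := le_trans (by norm_num) hn80
  have hn0 : (0 : ℝ) < n := by linarith
  have hQ0 : 0 < Q n := one_pos.trans_le (hQ n)
  have hS1 : 1 ≤ S n := hD.one_le_space hS (by exact_mod_cast hn0)
  set θ := (n : ℝ) ^ δ with hθdef
  have hθ0 : 0 < θ := by positivity
  have hpow : (n : ℝ) ^ (3 - 10 * δ) = (n : ℝ) ^ 3 / θ ^ 10 := by
    rw [Real.rpow_sub hn0, hθdef, ← Real.rpow_natCast ((n : ℝ) ^ δ), ← Real.rpow_mul hn0.le]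
    congr 1
    · exact_mod_cast Real.rpow_natCast (n : ℝ) 3
    · congr 1
      push_cast
      ring
  rw [hpow, div_div, div_le_iff₀ (by positivity)]
  by_cases hn : 80 * Q n * θ * θ ≤ n
  · refine (cube_le_mul_space hD hS (hQ n) hγ hL hθ4 hθL hn hsmall).trans ?_
    calc 144 * 80 ^ 6 * (2 ^ (L + 1) * 2 ^ 2 ^ (L + 1)) * Q n ^ 5 * θ ^ 8 * S n
        ≤ θ * Q n ^ 5 * θ ^ 8 * S n := by gcongr
      _ = S n * (θ ^ 9 * Q n ^ 5) := by ring
      _ ≤ S n * (θ ^ 10 * Q n ^ 5) := by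
          gcongr
          · linarith
          · norm_num
  · -- The query time is almost linear, and the claimed bound drops below one cell.
    push Not at hn
    have h1 : (n : ℝ) ^ 5 ≤ 80 ^ 5 * (θ ^ 10 * Q n ^ 5) :=
      (pow_le_pow_left₀ hn0.le hn.le 5).trans_eq (by ring)
    have h2 : (80 : ℝ) ^ 5 * (n : ℝ) ^ 3 ≤ (n : ℝ) ^ 5 := by
      have h3 : (80 : ℝ) ^ 5 ≤ (n : ℝ) ^ 2 := hn80.trans (by nlinarith)
      calc (80 : ℝ) ^ 5 * (n : ℝ) ^ 3 ≤ (n : ℝ) ^ 2 * (n : ℝ) ^ 3 := by gcongr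
        _ = (n : ℝ) ^ 5 := by ring
    have h3 : (n : ℝ) ^ 3 ≤ θ ^ 10 * Q n ^ 5 := by
      have := h2.trans h1
      exact le_of_mul_le_mul_left this (by positivity)
    exact h3.trans (le_mul_of_one_le_left (by positivity) hS1)

/-- If a property holds eventually with every positive error, then it holds eventually with an
error that tends to zero. -/
lemma exists_tendsto_zero_of_forall_pos {G : ℕ → ℝ → Prop}
    (hmono : ∀ᶠ n in atTop, ∀ ε ε', ε ≤ ε' → G n ε → G n ε')
    (h : ∀ ε, 0 < ε → ∀ᶠ n in atTop, G n ε) :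
    ∃ η : ℕ → ℝ, Tendsto η atTop (𝓝 0) ∧ ∀ᶠ n in atTop, G n (η n) := by
  have hbdd : ∀ n, BddBelow {ε | 0 < ε ∧ G n ε} := fun n => ⟨0, fun ε hε => hε.1.le⟩
  have hnn : ∀ n, 0 ≤ sInf {ε | 0 < ε ∧ G n ε} := fun n => Real.sInf_nonneg fun ε hε => hε.1.le
  refine ⟨fun n => sInf {ε | 0 < ε ∧ G n ε} + 1 / ((n : ℝ) + 1), ?_, ?_⟩
  · have h0 : Tendsto (fun n : ℕ => sInf {ε | 0 < ε ∧ G n ε}) atTop (𝓝 0) := by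
      refine tendsto_order.2 ⟨fun a ha => Eventually.of_forall fun n => ha.trans_le (hnn n),
        fun a ha => ?_⟩
      filter_upwards [h (a / 2) (half_pos ha)] with n hn
      exact (csInf_le (hbdd n) ⟨half_pos ha, hn⟩).trans_lt (half_lt_self ha)
    simpa using h0.add tendsto_one_div_add_atTop_nhds_zero_nat
  · filter_upwards [hmono, h 1 one_pos] with n hn h1
    obtain ⟨ε, hε, hlt⟩ := exists_lt_of_csInf_lt (s := {ε | 0 < ε ∧ G n ε}) ⟨1, one_pos, h1⟩
      (lt_add_of_pos_right _ (by positivity : (0 : ℝ) < 1 / ((n : ℝ) + 1)))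
    exact hn _ _ hlt.le hε.2

lemma IsPolylogarithmic.eventually_pow_le {Q : ℕ → ℝ} (hQ : IsPolylogarithmic Q) {ε : ℝ}
    (hε : 0 < ε) : ∀ᶠ n : ℕ in atTop, max 1 (Q n) ^ 5 ≤ (n : ℝ) ^ ε := by
  obtain ⟨b, hb⟩ := hQ
  have h1 : (fun n : ℕ => Real.log (n : ℝ) ^ b) =o[atTop] fun n : ℕ => (n : ℝ) ^ (ε / 5) := by
    have := (isLittleO_log_rpow_rpow_atTop (b : ℝ) (by positivity : 0 < ε / 5)).comp_tendsto
      tendsto_natCast_atTop_atTop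
    simpa [Function.comp_def] using this
  have h2 := (hb.trans_isLittleO h1).bound one_pos
  filter_upwards [h2, eventually_ge_atTop 1] with n hn hn1
  have hn1' : (1 : ℝ) ≤ n := by exact_mod_cast hn1
  have h3 : max 1 (Q n) ≤ (n : ℝ) ^ (ε / 5) := by
    refine max_le (Real.one_le_rpow hn1' (by positivity)) ((le_abs_self _).trans ?_)
    rwa [one_mul, Real.norm_eq_abs, Real.norm_of_nonneg (by positivity)] at hn
  calc max 1 (Q n) ^ 5 ≤ ((n : ℝ) ^ (ε / 5)) ^ 5 :=
        pow_le_pow_left₀ (zero_le_one.trans (le_max_left _ _)) h3 5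
    _ = (n : ℝ) ^ ε := by
        rw [← Real.rpow_natCast, ← Real.rpow_mul (Nat.cast_nonneg n)]
        congr 1
        push_cast
        ring

theorem IsPolylogarithmic.exists_rpow_le_space {C : ℝ} {Q S : ℕ → ℝ}
    {D : (P : Finset Plane) → PointerStructure P} (hQ : IsPolylogarithmic Q)
    (hD : SolvesAnnulusReporting D Q C) (hS : UsesSpace D S) :
    ∃ η : ℕ → ℝ, Tendsto η atTop (𝓝 0) ∧ ∀ᶠ n : ℕ in atTop, (n : ℝ) ^ (3 - η n) ≤ S n := by
  refine exists_tendsto_zero_of_forall_pos (G := fun n ε => (n : ℝ) ^ (3 - ε) ≤ S n) ?_ ?_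
  · filter_upwards [eventually_ge_atTop 1] with n hn ε ε' hle h
    exact (Real.rpow_le_rpow_of_exponent_le (by exact_mod_cast hn) (by linarith)).trans h
  · intro ε hε
    filter_upwards [eventually_rpow_div_le_space C (half_pos hε),
      hQ.eventually_pow_le (half_pos hε), eventually_gt_atTop 0] with n h1 h2 hn
    have hn0 : (0 : ℝ) < n := by exact_mod_cast hn
    have hmax : (0 : ℝ) < max 1 (Q n) := one_pos.trans_le (le_max_left _ _)
    refine le_trans ?_ (h1 (fun n => max 1 (Q n)) S D (fun n => le_max_left _ _)
      (hD.mono fun n => le_max_right _ _) hS)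
    rw [le_div_iff₀ (by positivity)]
    calc (n : ℝ) ^ (3 - ε) * max 1 (Q n) ^ 5 ≤ (n : ℝ) ^ (3 - ε) * (n : ℝ) ^ (ε / 2) := by gcongr
      _ = (n : ℝ) ^ (3 - ε / 2) := by
          rw [← Real.rpow_add hn0]
          congr 1
          ring

theorem mainTheorem2 :
    -- Space `n ^ (3 - o(1)) / Q(n) ^ 5`, where the `o(1)` depends only on the constant in `O(k)`.
    (∀ C : ℝ, ∃ η : ℕ → ℝ, Tendsto η atTop (𝓝 0) ∧ ∃ N : ℕ,
      ∀ (Q S : ℕ → ℝ) (D : (P : Finset Plane) → PointerStructure P),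
        (∀ n, 1 ≤ Q n) → SolvesAnnulusReporting D Q C → UsesSpace D S →
          ∀ n : ℕ, N ≤ n → (n : ℝ) ^ (3 - η n) / Q n ^ 5 ≤ S n) ∧
    -- Polylogarithmic query time requires space `n ^ (3 - o(1))`.
    (∀ (C : ℝ) (Q S : ℕ → ℝ) (D : (P : Finset Plane) → PointerStructure P),
      IsPolylogarithmic Q → SolvesAnnulusReporting D Q C → UsesSpace D S →
        ∃ η : ℕ → ℝ, Tendsto η atTop (𝓝 0) ∧ ∀ᶠ n : ℕ in atTop, (n : ℝ) ^ (3 - η n) ≤ S n) ∧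
    -- So polylogarithmic query time with space `n ^ (2 + o(1))` is impossible.
    (¬ ∃ (C : ℝ) (Q S : ℕ → ℝ) (D : (P : Finset Plane) → PointerStructure P),
      IsPolylogarithmic Q ∧ SolvesAnnulusReporting D Q C ∧ UsesSpace D S ∧
        ∃ η : ℕ → ℝ, Tendsto η atTop (𝓝 0) ∧
          ∀ᶠ n : ℕ in atTop, S n ≤ (n : ℝ) ^ (2 + η n)) := by
  refine ⟨fun C => ?_, fun C Q S D hQ hD hS => hQ.exists_rpow_le_space hD hS, ?_⟩
  · obtain ⟨η, hη, h⟩ := exists_tendsto_zero_of_forall_pos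
      (G := fun n ε => ∀ (Q S : ℕ → ℝ) (D : (P : Finset Plane) → PointerStructure P),
        (∀ n, 1 ≤ Q n) → SolvesAnnulusReporting D Q C → UsesSpace D S →
          (n : ℝ) ^ (3 - ε) / Q n ^ 5 ≤ S n)
      (by
        filter_upwards [eventually_ge_atTop 1] with n hn ε ε' hle h Q S D hQ hD hS
        refine le_trans (div_le_div_of_nonneg_right ?_ ?_) (h Q S D hQ hD hS)
        · exact Real.rpow_le_rpow_of_exponent_le (by exact_mod_cast hn) (by linarith)
        · exact pow_nonneg (zero_le_one.trans (hQ n)) 5)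
      fun ε hε => eventually_rpow_div_le_space C hε
    obtain ⟨N, hN⟩ := eventually_atTop.1 h
    exact ⟨η, hη, N, fun Q S D hQ hD hS n hn => hN n hn Q S D hQ hD hS⟩
  · rintro ⟨C, Q, S, D, hQ, hD, hS, η', hη', hle⟩
    obtain ⟨η, hη, hge⟩ := hQ.exists_rpow_le_space hD hS
    have hsum : Tendsto (fun n => η n + η' n) atTop (𝓝 0) := by simpa using hη.add hη'
    obtain ⟨n, h1, h2, h3, hn⟩ := (hle.and (hge.and
      ((hsum.eventually_lt_const one_pos).and (eventually_gt_atTop 1)))).exists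
    have hn1 : (1 : ℝ) < n := by exact_mod_cast hn
    have := (Real.rpow_le_rpow_left_iff hn1).1 (h2.trans h1)
    linarith
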